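/- Let $n\ge 4$, $p\ge 0$ and $m\ge 2$ be integers, let $M^n$ be a nonempty conformally flat smooth Riemannian manifold (each point has an open neighbourhood conformal to an open subset of $\mathbb{R}^n$), and let $f\colon M^n\to\mathbb{R}^{n+p}$ be a smooth isometric immersion with normal spaces $N_fM(x)$ and second fundamental form $\alpha_f$. For $\eta\in N_fM(x)$ put $$E_\eta(x)=\{X\in T_xM:\ \alpha_f(X,Y)=\langle X,Y\rangle\,\eta\ \text{ for all } Y\in T_xM\},$$ and call $\eta$ a principal normal of $f$ at $x$ if $\dim E_\eta(x)>0$. Assume that - $f$ has flat normal bundle, i.e. the curvature tensor of the normal connection vanishes at every point; - $f$ is proper, i.e. the number of distinct principal normals of $f$ at $x$ is finite and does not depend on $x\in M^n$; - $f$ carries a principal normal vector field of multiplicity $m$, i.e. a smooth normal vector field $\eta$ with $\dim E_{\eta(x)}(x)=m$ for every $x\in M^n$. Then $p\ge n-m$, and $f$ is quasiumbilical: at every point $x\in M^n$ there exists an orthonormal basis $\xi_1,\dots,\xi_p$ of $N_fM(x)$ such that each shape operator $A_{\xi_j}$, $1\le j\le p$ (defined by $\langle A_{\xi_j}X,Y\rangle=\langle\alpha_f(X,Y),\xi_j\rangle$),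 has an eigenvalue of multiplicity at least $n-1$. -/

import Mathlib

open scoped Manifold ContDiff

noncomputable section

namespace EuclideanSubmanifold

/-- Euclidean space `ℝᵏ` with its standard inner product. -/
abbrev Euc (k : ℕ) : Type := EuclideanSpace ℝ (Fin k)

/-- The tangent space `T_xM` of a manifold `M` modelled on `ℝⁿ`. -/
abbrev Tan (n : ℕ) {M : Type*} [TopologicalSpace M] [ChartedSpace (Euc n) M] (x : M) : Type :=
  TangentSpace 𝓘(ℝ, Euc n) x

/-- A smooth Riemannian metric on a manifold `M` modelled on `ℝⁿ`. -/
abbrev Metric (n : ℕ) (M : Type*) [TopologicalSpace M] [ChartedSpace (Euc n) M]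
    [IsManifold 𝓘(ℝ, Euc n) ∞ M] : Type _ :=
  Bundle.ContMDiffRiemannianMetric 𝓘(ℝ, Euc n) ∞ (Euc n) (fun x : M => Tan n x)

section

variable (n : ℕ) {N : ℕ} {M : Type*} [TopologicalSpace M] [ChartedSpace (Euc n) M]

/-- The differential `df_x : T_xM → ℝᴺ` of a map `f : M → ℝᴺ`. -/
def differential (f : M → Euc N) (x : M) : Tan n x →L[ℝ] Euc N :=
  mfderiv 𝓘(ℝ, Euc n) 𝓘(ℝ, Euc N) f x

/-- The normal space `N_fM(x)`: the orthogonal complement of `df_x(T_xM)` in `ℝᴺ`. -/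
def normalSpace (f : M → Euc N) (x : M) : Submodule ℝ (Euc N) :=
  (differential n f x).rangeᗮ

/-- A map `h` defined on `M`, read in the preferred chart at `x`. -/
def inChart {F : Type*} (h : M → F) (x : M) : Euc n → F :=
  fun y => h ((extChartAt 𝓘(ℝ, Euc n) x).symm y)

/-- The point of `ℝⁿ` that represents `x` in the preferred chart at `x`. -/
def chartPoint (x : M) : Euc n := extChartAt 𝓘(ℝ, Euc n) x x

/-- The second fundamental form `α_f(X, Y) ∈ N_fM(x)` for `X, Y ∈ T_xM`: the normal component
of the second derivative `D_X D_Y f`. The second derivative is taken in the preferred chart at `x`,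
which is the chart through which `TangentSpace` identifies `T_xM` with `ℝⁿ`; the vectors `X`, `Y`
are thus extended as fields with constant coefficients in that chart, and the normal
component does not depend on the extension. -/
def secondFundamentalForm (f : M → Euc N) (x : M) (X Y : Tan n x) : Euc N :=
  (normalSpace n f x).starProjection
    (fderiv ℝ (fderiv ℝ (inChart n f x)) (chartPoint n x) (X : Euc n) (Y : Euc n))

theorem secondFundamentalForm_add_left (f : M → Euc N) (x : M) (X X' Y : Tan n x) :
    secondFundamentalForm n f x (X + X') Y
      = secondFundamentalForm n f x X Y + secondFundamentalForm n f x X' Y := by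
  unfold secondFundamentalForm
  exact (congrArg (normalSpace n f x).starProjection
    (congrArg (fun L : Euc n →L[ℝ] Euc N => L Y)
      ((fderiv ℝ (fderiv ℝ (inChart n f x)) (chartPoint n x)).map_add X X'))).trans
    (map_add _ _ _)

theorem secondFundamentalForm_smul_left (f : M → Euc N) (x : M) (c : ℝ) (X Y : Tan n x) :
    secondFundamentalForm n f x (c • X) Y
      = c • secondFundamentalForm n f x X Y := by
  unfold secondFundamentalForm
  exact (congrArg (normalSpace n f x).starProjection
    (congrArg (fun L : Euc n →L[ℝ] Euc N => L Y)
      ((fderiv ℝ (fderiv ℝ (inChart n f x)) (chartPoint n x)).map_smul c X))).trans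
    ((normalSpace n f x).starProjection.map_smul c _)

theorem secondFundamentalForm_add_right (f : M → Euc N) (x : M) (X Y Y' : Tan n x) :
    secondFundamentalForm n f x X (Y + Y')
      = secondFundamentalForm n f x X Y + secondFundamentalForm n f x X Y' := by
  unfold secondFundamentalForm
  exact (congrArg (normalSpace n f x).starProjection
    ((fderiv ℝ (fderiv ℝ (inChart n f x)) (chartPoint n x) X).map_add Y Y')).trans
    (map_add _ _ _)

theorem secondFundamentalForm_smul_right (f : M → Euc N) (x : M) (c : ℝ) (X Y : Tan n x) :
    secondFundamentalForm n f x X (c • Y)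
      = c • secondFundamentalForm n f x X Y := by
  unfold secondFundamentalForm
  exact (congrArg (normalSpace n f x).starProjection
    ((fderiv ℝ (fderiv ℝ (inChart n f x)) (chartPoint n x) X).map_smul c Y)).trans
    (map_smul _ _ _)

/-- The subspace `E_η(x) = {X ∈ T_xM : α_f(X, Y) = ⟨X, Y⟩ η for all Y ∈ T_xM}`. -/
def principalSpace [IsManifold 𝓘(ℝ, Euc n) ∞ M] (g : Metric n M) (f : M → Euc N) (x : M)
    (η : Euc N) : Submodule ℝ (Tan n x) where
  carrier := {X | ∀ Y : Tan n x, secondFundamentalForm n f x X Y = g.inner x X Y • η}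
  zero_mem' := by
    intro Y
    have h := secondFundamentalForm_smul_left n f x 0 0 Y
    rw [zero_smul, zero_smul] at h
    simp [h]
  add_mem' := by
    intro X X' hX hX' Y
    rw [secondFundamentalForm_add_left, hX Y, hX' Y]
    simp [add_smul]
  smul_mem' := by
    intro c X hX Y
    rw [secondFundamentalForm_smul_left, hX Y]
    simp [mul_smul]

/-- `f : (M, g) → ℝᴺ` is a smooth isometric immersion. (Positivity of `g` makes every
`df_x` injective.) -/
def IsIsometricImmersion [IsManifold 𝓘(ℝ, Euc n) ∞ M] (g : Metric n M) (f : M → Euc N) : Prop :=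
  ContMDiff 𝓘(ℝ, Euc n) 𝓘(ℝ, Euc N) ∞ f ∧
    ∀ (x : M) (X Y : Tan n x), inner ℝ (differential n f x X) (differential n f x Y) = g.inner x X Y

/-- `(M, g)` is conformally flat: every point has an open neighbourhood (the source of `φ`) with a
conformal diffeomorphism `φ` onto an open subset of `ℝⁿ`. -/
def IsConformallyFlat [IsManifold 𝓘(ℝ, Euc n) ∞ M] (g : Metric n M) : Prop :=
  ∀ x : M, ∃ (φ : OpenPartialHomeomorph M (Euc n)) (lam : M → ℝ),
    x ∈ φ.source ∧
    ContMDiffOn 𝓘(ℝ, Euc n) 𝓘(ℝ, Euc n) ∞ φ φ.source ∧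
    ContMDiffOn 𝓘(ℝ, Euc n) 𝓘(ℝ, Euc n) ∞ φ.symm φ.target ∧
    ContMDiffOn 𝓘(ℝ, Euc n) 𝓘(ℝ, ℝ) ∞ lam φ.source ∧
    ∀ y ∈ φ.source, 0 < lam y ∧ ∀ X Y : Tan n y,
      inner ℝ (differential n φ y X) (differential n φ y Y) = lam y ^ 2 * g.inner y X Y

/-- The covariant derivative in the normal connection, `∇⊥_v ξ = (D_v ξ)⊥`, written in the
preferred chart at `x`: here `ξ` is a field along `f` expressed in that chart, `v` stands for the
coordinate field with constant coefficients `v`, and `y` is a point of the chart domain. -/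
def normalDeriv (f : M → Euc N) (x : M) (v : Euc n) (ξ : Euc n → Euc N) (y : Euc n) : Euc N :=
  (inChart n (normalSpace n f) x y).starProjection (fderiv ℝ ξ y v)

/-- The normal curvature `R⊥(X, Y)ξ = ∇⊥_X ∇⊥_Y ξ - ∇⊥_Y ∇⊥_X ξ - ∇⊥_[X, Y] ξ` at `x` of a
normal field `ξ`. The vectors `X, Y ∈ T_xM` are extended as fields with constant coefficients in
the preferred chart at `x`, so that `[X, Y] = 0`. -/
def normalCurvature (f : M → Euc N) (x : M) (X Y : Tan n x) (ξ : M → Euc N) : Euc N :=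
  normalDeriv n f x (X : Euc n) (normalDeriv n f x (Y : Euc n) (inChart n ξ x)) (chartPoint n x)
    - normalDeriv n f x (Y : Euc n) (normalDeriv n f x (X : Euc n) (inChart n ξ x)) (chartPoint n x)

/-- `ξ` is a smooth normal vector field of `f` on the set `U`. -/
def IsNormalFieldOn (f : M → Euc N) (ξ : M → Euc N) (U : Set M) : Prop :=
  ContMDiffOn 𝓘(ℝ, Euc n) 𝓘(ℝ, Euc N) ∞ ξ U ∧ ∀ y ∈ U, ξ y ∈ normalSpace n f y

/-- `f` has flat normal bundle: the curvature tensor of the normal connection vanishes at every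
point. -/
def HasFlatNormalBundle (f : M → Euc N) : Prop :=
  ∀ (x : M) (U : Set M) (ξ : M → Euc N), IsOpen U → x ∈ U → IsNormalFieldOn n f ξ U →
    ∀ X Y : Tan n x, normalCurvature n f x X Y ξ = 0

/-- The set of principal normals of `f` at `x`: the normal vectors `η` with `dim E_η(x) > 0`. -/
def principalNormals [IsManifold 𝓘(ℝ, Euc n) ∞ M] (g : Metric n M) (f : M → Euc N) (x : M) :
    Set (Euc N) :=
  {η | η ∈ normalSpace n f x ∧ 0 < Module.finrank ℝ (principalSpace n g f x η)}

/-- `f` is proper: the number of its principal normals is finite and does not depend on the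
point. -/
def IsProper [IsManifold 𝓘(ℝ, Euc n) ∞ M] (g : Metric n M) (f : M → Euc N) : Prop :=
  ∃ k : ℕ, ∀ x : M, (principalNormals n g f x).encard = k

/-- `η` is a principal normal vector field of `f` of (constant) multiplicity `m`. -/
def IsPrincipalNormalField [IsManifold 𝓘(ℝ, Euc n) ∞ M] (g : Metric n M) (f : M → Euc N)
    (η : M → Euc N) (m : ℕ) : Prop :=
  IsNormalFieldOn n f η Set.univ ∧ 0 < m ∧
    ∀ x : M, Module.finrank ℝ (principalSpace n g f x (η x)) = m

/-- The metric on `T_xM` as a bilinear form. -/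
def metricForm [IsManifold 𝓘(ℝ, Euc n) ∞ M] (g : Metric n M) (x : M) :
    LinearMap.BilinForm ℝ (Tan n x) :=
  LinearMap.mk₂ ℝ (fun X Y => g.inner x X Y) (by simp) (by simp) (by simp) (by simp)

theorem metricForm_nondegenerate [IsManifold 𝓘(ℝ, Euc n) ∞ M] (g : Metric n M) (x : M) :
    (metricForm n g x).Nondegenerate := by
  constructor
  · intro X hX
    by_contra h
    exact (g.pos x X h).ne' (hX X)
  · intro X hX
    by_contra h
    exact (g.pos x X h).ne' (hX X)

/-- The bilinear form `(X, Y) ↦ ⟨α_f(X, Y), ξ⟩` on `T_xM`. -/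
def secondFormAlong (f : M → Euc N) (x : M) (ξ : Euc N) : LinearMap.BilinForm ℝ (Tan n x) :=
  LinearMap.mk₂ ℝ (fun X Y => inner ℝ (secondFundamentalForm n f x X Y) ξ)
    (fun X X' Y => by rw [secondFundamentalForm_add_left, inner_add_left])
    (fun c X Y => by rw [secondFundamentalForm_smul_left, real_inner_smul_left, smul_eq_mul])
    (fun X Y Y' => by rw [secondFundamentalForm_add_right, inner_add_left])
    (fun c X Y => by rw [secondFundamentalForm_smul_right, real_inner_smul_left, smul_eq_mul])

instance (x : M) : FiniteDimensional ℝ (Tan n x) :=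
  inferInstanceAs (FiniteDimensional ℝ (Euc n))

/-- The shape operator `A_ξ : T_xM → T_xM`: the linear map with
`⟨A_ξ X, Y⟩ = ⟨α_f(X, Y), ξ⟩` for all `X, Y ∈ T_xM`. -/
def shapeOperator [IsManifold 𝓘(ℝ, Euc n) ∞ M] (g : Metric n M) (f : M → Euc N) (x : M)
    (ξ : Euc N) : Module.End ℝ (Tan n x) :=
  (secondFormAlong n f x ξ).symmCompOfNondegenerate (metricForm n g x) (metricForm_nondegenerate n g x)

/-- The defining property of the shape operator. -/
theorem inner_shapeOperator [IsManifold 𝓘(ℝ, Euc n) ∞ M] (g : Metric n M) (f : M → Euc N) (x : M)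
    (ξ : Euc N) (X Y : Tan n x) :
    g.inner x (shapeOperator n g f x ξ X) Y = inner ℝ (secondFundamentalForm n f x X Y) ξ :=
  LinearMap.BilinForm.symmCompOfNondegenerate_left_apply (secondFormAlong n f x ξ)
    (metricForm_nondegenerate n g x) Y X

end

/-- `f : (Mⁿ, g) → ℝⁿ⁺ᵖ` is quasiumbilical: at every point there is an orthonormal basis
`ξ₁, …, ξ_p` of the normal space such that each shape operator `A_{ξ_j}` has an eigenvalue of
multiplicity at least `n - 1`. -/
def IsQuasiumbilical {n p : ℕ} {M : Type*} [TopologicalSpace M] [ChartedSpace (Euc n) M]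
    [IsManifold 𝓘(ℝ, Euc n) ∞ M] (g : Metric n M) (f : M → Euc (n + p)) : Prop :=
  ∀ x : M, ∃ ξ : OrthonormalBasis (Fin p) ℝ (normalSpace n f x), ∀ j : Fin p, ∃ c : ℝ,
    n - 1 ≤ Module.finrank ℝ (Module.End.eigenspace (shapeOperator n g f x (ξ j)) c)

end EuclideanSubmanifold

end

/-!
The statement is pointwise. By the Ricci equation a flat normal bundle makes the shape operators at
`x` commute, so `α_f` is diagonal in an orthonormal basis of `T_xM`, with normal vectors `l i` on
the diagonal. Conformal flatness and the Gauss equation say that the sectional curvature of the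
plane of the `i`th and `j`th basis vectors is a sum, `⟨l i, l j⟩ = s i + s j` for `i ≠ j`. If
`l a = l b = η` for some `a ≠ b`, then for `i ≠ j` different from `a` and `b`
`⟨l i - η, l j - η⟩ = (s i + s j) - (s i + s a) - (s b + s j) + (s a + s b) = 0`.
Hence the `n - m` nonzero differences `l i - η` are pairwise orthogonal in the `p`-dimensional
normal space, which gives `n - m ≤ p`. Normalize them and complete them to an orthonormal basis:
for a member `ξ` of it, `⟨l i, ξ⟩ = ⟨η, ξ⟩` for all `i` with at most one exception, that is,
`⟨η, ξ⟩` is an eigenvalue of `A_ξ` of multiplicity at least `n - 1`.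
This last step is `exists_orthonormalBasis_of_inner_eq_add`.

The curvature tensor of `M` is never needed. In a conformal chart `φ` the map `F = f ∘ φ⁻¹` is a
conformal immersion of an open subset of `ℝⁿ`, `⟨F_U, F_V⟩ = ρ ⟨U, V⟩`, and differentiating this
relation twice (`exists_sum_eq_gauss_of_conformal`) expresses
`⟨B(U, U), B(V, V)⟩ - |B(U, V)|²`, with `B` the normal part of the second derivative, as
`s U + s V` for orthonormal `U`, `V`. The Ricci equation (`inner_fderiv_shape_comm`) is obtained
from the derivatives of the orthogonal projection `P` onto the normal spaces: on a normal vector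
the curvature is `P [∂_X P, ∂_Y P]`. The smoothness of `P` is read off in a conformal chart, where
it has a closed form. The bridge between the two charts is `IsConformalChart.exists_linearEquiv`.
-/

/-! ### The Gauss equation of a conformal immersion -/

open Filter Topology in
theorem fderiv_inner_fderiv_fderiv {E H : Type*}
    [NormedAddCommGroup E] [InnerProductSpace ℝ E]
    [NormedAddCommGroup H] [InnerProductSpace ℝ H]
    {F : E → H} {ρ : E → ℝ} {z : E} (hF : ContDiffAt ℝ 2 F z) (hρ : DifferentiableAt ℝ ρ z)
    (hc : ∀ᶠ y in 𝓝 z, ∀ U V, inner ℝ (fderiv ℝ F y U) (fderiv ℝ F y V) = ρ y * inner ℝ U V)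
    (W U V : E) :
    inner ℝ (fderiv ℝ (fderiv ℝ F) z W U) (fderiv ℝ F z V)
      + inner ℝ (fderiv ℝ F z U) (fderiv ℝ (fderiv ℝ F) z W V) = fderiv ℝ ρ z W * inner ℝ U V := by
  have hd : DifferentiableAt ℝ (fderiv ℝ F) z :=
    (hF.fderiv_right (m := 1) (by norm_num)).differentiableAt (by norm_num)
  have h1 : (fun y => inner ℝ (fderiv ℝ F y U) (fderiv ℝ F y V)) =ᶠ[𝓝 z]
      fun y => ρ y * inner ℝ U V := hc.mono fun y hy => hy U V
  have h2 := congrArg (fun T : E →L[ℝ] ℝ => T W) h1.fderiv_eq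
  have hU : HasFDerivAt (fun y => fderiv ℝ F y U) ((fderiv ℝ (fderiv ℝ F) z).flip U) z := by
    simpa using hd.hasFDerivAt.clm_apply (hasFDerivAt_const U z)
  have hV : HasFDerivAt (fun y => fderiv ℝ F y V) ((fderiv ℝ (fderiv ℝ F) z).flip V) z := by
    simpa using hd.hasFDerivAt.clm_apply (hasFDerivAt_const V z)
  rw [(hU.inner ℝ hV).fderiv, (hρ.hasFDerivAt.mul_const _).fderiv] at h2
  simp at h2
  linarith

open Filter Topology in
/-- The Koszul formula for the metric `ρ ⟨·, ·⟩` induced by a conformal immersion `F`: it gives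
the tangential part of the second derivative of `F`. -/
theorem inner_sndFDeriv_fderiv_of_conformal {E H : Type*}
    [NormedAddCommGroup E] [InnerProductSpace ℝ E]
    [NormedAddCommGroup H] [InnerProductSpace ℝ H]
    {F : E → H} {ρ : E → ℝ} {z : E} (hF : ContDiffAt ℝ 2 F z) (hρ : DifferentiableAt ℝ ρ z)
    (hc : ∀ᶠ y in 𝓝 z, ∀ U V, inner ℝ (fderiv ℝ F y U) (fderiv ℝ F y V) = ρ y * inner ℝ U V)
    (U V W : E) :
    inner ℝ (fderiv ℝ (fderiv ℝ F) z U V) (fderiv ℝ F z W) =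
      (fderiv ℝ ρ z U * inner ℝ V W + fderiv ℝ ρ z V * inner ℝ U W
        - fderiv ℝ ρ z W * inner ℝ U V) / 2 := by
  have hs : IsSymmSndFDerivAt ℝ F z := hF.isSymmSndFDerivAt (by simp)
  have h1 := fderiv_inner_fderiv_fderiv hF hρ hc U V W
  have h2 := fderiv_inner_fderiv_fderiv hF hρ hc V U W
  have h3 := fderiv_inner_fderiv_fderiv hF hρ hc W U V
  rw [hs V U] at h2
  rw [hs W U, hs W V] at h3
  have e1 := real_inner_comm (fderiv ℝ F z V) (fderiv ℝ (fderiv ℝ F) z U W)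
  have e2 := real_inner_comm (fderiv ℝ F z U) (fderiv ℝ (fderiv ℝ F) z V W)
  linarith

open Filter Topology in
/-- The Gauss equation of a conformal immersion `F`, before splitting the second derivative into
tangential and normal parts: for orthonormal `U`, `V` the expression below only involves
the second derivatives of the conformal factor in the directions `U` and `V`. -/
theorem gauss_sndFDeriv_of_conformal {E H : Type*}
    [NormedAddCommGroup E] [InnerProductSpace ℝ E]
    [NormedAddCommGroup H] [InnerProductSpace ℝ H]
    {F : E → H} {ρ : E → ℝ} {z : E} (hF : ContDiffAt ℝ 3 F z) (hρ : ContDiffAt ℝ 2 ρ z)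
    (hc : ∀ᶠ y in 𝓝 z, ∀ U V, inner ℝ (fderiv ℝ F y U) (fderiv ℝ F y V) = ρ y * inner ℝ U V)
    {U V : E} (hU : ‖U‖ = 1) (hV : ‖V‖ = 1) (hUV : inner ℝ U V = 0) :
    inner ℝ (fderiv ℝ (fderiv ℝ F) z U U) (fderiv ℝ (fderiv ℝ F) z V V)
      - inner ℝ (fderiv ℝ (fderiv ℝ F) z U V) (fderiv ℝ (fderiv ℝ F) z U V) =
    -(fderiv ℝ (fderiv ℝ ρ) z U U + fderiv ℝ (fderiv ℝ ρ) z V V) / 2 := by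
  have hUU : inner ℝ U U = 1 := by rw [real_inner_self_eq_norm_sq, hU]; norm_num
  have hVV : inner ℝ V V = 1 := by rw [real_inner_self_eq_norm_sq, hV]; norm_num
  have hVU : inner ℝ V U = 0 := by rw [real_inner_comm, hUV]
  have hF1 : ContDiffAt ℝ 2 (fderiv ℝ F) z := hF.fderiv_right (by norm_num)
  have hF2 : ContDiffAt ℝ 1 (fderiv ℝ (fderiv ℝ F)) z := hF1.fderiv_right (by norm_num)
  have d1 : HasFDerivAt (fderiv ℝ F) (fderiv ℝ (fderiv ℝ F) z) z :=
    (hF1.differentiableAt (by norm_num)).hasFDerivAt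
  have d2 : HasFDerivAt (fderiv ℝ (fderiv ℝ F)) (fderiv ℝ (fderiv ℝ (fderiv ℝ F)) z) z :=
    (hF2.differentiableAt (by norm_num)).hasFDerivAt
  have dρ : HasFDerivAt (fderiv ℝ ρ) (fderiv ℝ (fderiv ℝ ρ) z) z :=
    ((hρ.fderiv_right (m := 1) (by norm_num)).differentiableAt (by norm_num)).hasFDerivAt
  have hF' : ∀ᶠ y in 𝓝 z, ContDiffAt ℝ 2 F y :=
    (hF.of_le (by norm_num)).eventually (by simp)
  have hρ' : ∀ᶠ y in 𝓝 z, DifferentiableAt ℝ ρ y :=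
    (hρ.eventually (by simp)).mono fun y hy => hy.differentiableAt (by norm_num)
  have key : ∀ᶠ y in 𝓝 z, ∀ A B C, inner ℝ (fderiv ℝ (fderiv ℝ F) y A B) (fderiv ℝ F y C) =
      (fderiv ℝ ρ y A * inner ℝ B C + fderiv ℝ ρ y B * inner ℝ A C
        - fderiv ℝ ρ y C * inner ℝ A B) / 2 := by
    filter_upwards [hF', hρ', hc.eventually_nhds] with y h1 h2 h3 A B C
    exact inner_sndFDeriv_fderiv_of_conformal h1 h2 h3 A B C
  have D1 : ∀ A, HasFDerivAt (fun y => fderiv ℝ F y A) ((fderiv ℝ (fderiv ℝ F) z).flip A) z :=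
    fun A => by simpa using d1.clm_apply (hasFDerivAt_const A z)
  have D2 : ∀ A B, HasFDerivAt (fun y => fderiv ℝ (fderiv ℝ F) y A B)
      (((fderiv ℝ (fderiv ℝ (fderiv ℝ F)) z).flip A).flip B) z := fun A B => by
    have h : HasFDerivAt (fun y => fderiv ℝ (fderiv ℝ F) y A)
        ((fderiv ℝ (fderiv ℝ (fderiv ℝ F)) z).flip A) z := by
      simpa using d2.clm_apply (hasFDerivAt_const A z)
    simpa using h.clm_apply (hasFDerivAt_const B z)
  have Dρ : ∀ A, HasFDerivAt (fun y => fderiv ℝ ρ y A) ((fderiv ℝ (fderiv ℝ ρ) z).flip A) z :=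
    fun A => by simpa using dρ.clm_apply (hasFDerivAt_const A z)
  -- differentiate `⟨F_UV, F_V⟩ = ρ_U / 2` in the direction `U`
  have e1 : (fun y => inner ℝ (fderiv ℝ (fderiv ℝ F) y U V) (fderiv ℝ F y V)) =ᶠ[𝓝 z]
      fun y => fderiv ℝ ρ y U * (1 / 2) := by
    filter_upwards [key] with y hy
    rw [hy, hVV, hUV]; ring
  have f1 := congrArg (fun T : E →L[ℝ] ℝ => T U) e1.fderiv_eq
  rw [((D2 U V).inner ℝ (D1 V)).fderiv, ((Dρ U).mul_const _).fderiv] at f1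
  -- differentiate `⟨F_UU, F_V⟩ = -ρ_V / 2` in the direction `V`
  have e2 : (fun y => inner ℝ (fderiv ℝ (fderiv ℝ F) y U U) (fderiv ℝ F y V)) =ᶠ[𝓝 z]
      fun y => fderiv ℝ ρ y V * (-1 / 2) := by
    filter_upwards [key] with y hy
    rw [hy, hUU, hUV]; ring
  have f2 := congrArg (fun T : E →L[ℝ] ℝ => T V) e2.fderiv_eq
  rw [((D2 U U).inner ℝ (D1 V)).fderiv, ((Dρ V).mul_const _).fderiv] at f2
  -- the third derivatives cancel by symmetry
  have s1 : fderiv ℝ (fderiv ℝ (fderiv ℝ F)) z U U V = fderiv ℝ (fderiv ℝ (fderiv ℝ F)) z U V U := by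
    have h : (fun y => fderiv ℝ (fderiv ℝ F) y U V) =ᶠ[𝓝 z]
        fun y => fderiv ℝ (fderiv ℝ F) y V U := by
      filter_upwards [hF'] with y hy
      exact hy.isSymmSndFDerivAt (by simp) U V
    have := congrArg (fun T : E →L[ℝ] H => T U) h.fderiv_eq
    rw [(D2 U V).fderiv, (D2 V U).fderiv] at this
    simpa using this
  have s2 : fderiv ℝ (fderiv ℝ (fderiv ℝ F)) z U V = fderiv ℝ (fderiv ℝ (fderiv ℝ F)) z V U :=
    hF1.isSymmSndFDerivAt (by simp) U V
  simp [-one_div] at f1 f2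
  rw [s1, s2] at f1
  rw [real_inner_self_eq_norm_sq]
  linarith

/-- Projection onto the orthogonal complement of the range of a conformal linear map `T`: the
vector `a` plays the role of the adjoint of `T` applied to `v`. -/
theorem starProjection_range_of_conformal {E H : Type*}
    [NormedAddCommGroup E] [InnerProductSpace ℝ E] [FiniteDimensional ℝ E]
    [NormedAddCommGroup H] [InnerProductSpace ℝ H] [FiniteDimensional ℝ H]
    {T : E →L[ℝ] H} {ρ : ℝ} (hρ : 0 < ρ)
    (hT : ∀ U V, inner ℝ (T U) (T V) = ρ * inner ℝ U V) {v : H} {a : E}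
    (ha : ∀ W, inner ℝ v (T W) = inner ℝ a W) :
    T.rangeᗮ.starProjection v = v - T (ρ⁻¹ • a) := by
  apply Submodule.eq_starProjection_of_mem_orthogonal
  · rintro _ ⟨W, rfl⟩
    rw [real_inner_comm]
    change inner ℝ _ (T W) = 0
    rw [inner_sub_left, ha, hT, real_inner_smul_left]
    field_simp
    ring
  · rw [sub_sub_cancel]
    exact Submodule.le_orthogonal_orthogonal _ ⟨_, rfl⟩

open Filter Topology in
/-- The conformal case of the Gauss equation: the metric induced by a conformal immersion `F` is
conformally flat, so its sectional curvatures, here expressed through the normal part of the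
second derivative, are sums of the values at the two directions of a single function, which is the
vanishing of the Weyl tensor. -/
theorem exists_sum_eq_gauss_of_conformal {E H : Type*}
    [NormedAddCommGroup E] [InnerProductSpace ℝ E] [FiniteDimensional ℝ E]
    [NormedAddCommGroup H] [InnerProductSpace ℝ H] [FiniteDimensional ℝ H]
    {F : E → H} {ρ : E → ℝ} {z : E} (hF : ContDiffAt ℝ 3 F z) (hρ : ContDiffAt ℝ 2 ρ z)
    (hpos : 0 < ρ z)
    (hc : ∀ᶠ y in 𝓝 z, ∀ U V, inner ℝ (fderiv ℝ F y U) (fderiv ℝ F y V) = ρ y * inner ℝ U V)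
    {B : E → E → H}
    (hB : ∀ U V, B U V = (fderiv ℝ F z).rangeᗮ.starProjection (fderiv ℝ (fderiv ℝ F) z U V)) :
    ∃ s : E → ℝ, ∀ U V : E, ‖U‖ = 1 → ‖V‖ = 1 → inner ℝ U V = 0 →
      inner ℝ (B U U) (B V V) - inner ℝ (B U V) (B U V) = s U + s V := by
  refine ⟨fun U => -fderiv ℝ (fderiv ℝ ρ) z U U / 2 + 3 / (4 * ρ z) * (fderiv ℝ ρ z U) ^ 2
    - ‖fderiv ℝ ρ z‖ ^ 2 / (8 * ρ z), fun U V hU hV hUV => ?_⟩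
  have hUU : inner ℝ U U = 1 := by rw [real_inner_self_eq_norm_sq, hU]; norm_num
  have hVV : inner ℝ V V = 1 := by rw [real_inner_self_eq_norm_sq, hV]; norm_num
  have hVU : inner ℝ V U = 0 := by rw [real_inner_comm, hUV]
  have hT : ∀ U V, inner ℝ (fderiv ℝ F z U) (fderiv ℝ F z V) = ρ z * inner ℝ U V :=
    hc.self_of_nhds
  set r : E := (InnerProductSpace.toDual ℝ E).symm (fderiv ℝ ρ z) with hr
  have hrW : ∀ W, inner ℝ r W = fderiv ℝ ρ z W := fun W => by
    rw [hr, InnerProductSpace.toDual_symm_apply]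
  have hWr : ∀ W, inner ℝ W r = fderiv ℝ ρ z W := fun W => by rw [real_inner_comm, hrW]
  have hrr : fderiv ℝ ρ z r = ‖fderiv ℝ ρ z‖ ^ 2 := by
    rw [← hrW, real_inner_self_eq_norm_sq, hr, LinearIsometryEquiv.norm_map]
  let a : E → E → E := fun U V =>
    (1 / 2 : ℝ) • (fderiv ℝ ρ z U • V + fderiv ℝ ρ z V • U - inner ℝ U V • r)
  have ha : ∀ U V W, inner ℝ (fderiv ℝ (fderiv ℝ F) z U V) (fderiv ℝ F z W) =
      inner ℝ (a U V) W := fun U V W => by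
    rw [inner_sndFDeriv_fderiv_of_conformal (hF.of_le (by norm_num))
      (hρ.differentiableAt (by norm_num)) hc]
    simp only [a, real_inner_smul_left, inner_sub_left, inner_add_left, hrW]
    ring
  have hBB : ∀ U V U' V', inner ℝ (B U V) (B U' V') =
      inner ℝ (fderiv ℝ (fderiv ℝ F) z U V) (fderiv ℝ (fderiv ℝ F) z U' V')
        - (ρ z)⁻¹ * inner ℝ (a U V) (a U' V') := fun U V U' V' => by
    rw [hB, hB, starProjection_range_of_conformal hpos hT (ha U V),
      starProjection_range_of_conformal hpos hT (ha U' V')]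
    simp only [inner_sub_left, inner_sub_right, hT, ha]
    rw [real_inner_comm _ (fderiv ℝ F z _), ha]
    simp only [real_inner_smul_left, real_inner_smul_right]
    rw [real_inner_comm (a U V)]
    field_simp
    ring
  rw [hBB, hBB]
  have hG := gauss_sndFDeriv_of_conformal hF hρ hc hU hV hUV
  have hA : inner ℝ (a U U) (a V V) - inner ℝ (a U V) (a U V) =
      ‖fderiv ℝ ρ z‖ ^ 2 / 4 - 3 / 4 * ((fderiv ℝ ρ z U) ^ 2 + (fderiv ℝ ρ z V) ^ 2) := by
    simp only [a, real_inner_smul_left, real_inner_smul_right, inner_sub_left, inner_sub_right,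
      inner_add_left, inner_add_right, hUU, hVV, hUV, hVU, hWr, hrW, hrr, map_smul, map_sub,
      map_add, smul_eq_mul]
    ring
  have : (ρ z)⁻¹ * inner ℝ (a U U) (a V V) - (ρ z)⁻¹ * inner ℝ (a U V) (a U V) =
      ‖fderiv ℝ ρ z‖ ^ 2 / (4 * ρ z)
        - 3 / (4 * ρ z) * ((fderiv ℝ ρ z U) ^ 2 + (fderiv ℝ ρ z V) ^ 2) := by
    rw [← mul_sub, hA]; field_simp
  have h8 : ‖fderiv ℝ ρ z‖ ^ 2 / (4 * ρ z) = 2 * (‖fderiv ℝ ρ z‖ ^ 2 / (8 * ρ z)) := by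
    ring
  rw [h8] at this
  linarith

/-! ### Linear algebra of diagonal forms -/

/-- A family of commuting symmetric operators has an orthonormal basis of joint eigenvectors. -/
theorem exists_orthonormalBasis_joint_eigenvectors {E ι : Type*} [NormedAddCommGroup E]
    [InnerProductSpace ℝ E] [FiniteDimensional ℝ E] {n : ℕ} (hn : Module.finrank ℝ E = n)
    {S : ι → Module.End ℝ E} (hS : ∀ i, (S i).IsSymmetric) (hc : ∀ i j, Commute (S i) (S j)) :
    ∃ e : OrthonormalBasis (Fin n) ℝ E, ∀ i k, ∃ c : ℝ, S i (e k) = c • e k := by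
  classical
  have hint := LinearMap.IsSymmetric.directSum_isInternal_of_pairwise_commute hS
    (fun i j _ => hc i j)
  have horth := LinearMap.IsSymmetric.orthogonalFamily_iInf_eigenspaces hS
  let v : ∀ γ : ι → ℝ, OrthonormalBasis _ ℝ ↥(⨅ j, (S j).eigenspace (γ j)) :=
    fun γ => stdOrthonormalBasis ℝ _
  let b := hint.collectedBasis fun γ => (v γ).toBasis
  have hb : Orthonormal ℝ b := hint.collectedBasis_orthonormal horth fun γ => by
    simp [(v γ).orthonormal]
  have : Finite (Σ γ : ι → ℝ, Fin (Module.finrank ℝ ↥(⨅ j, (S j).eigenspace (γ j)))) :=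
    Module.Finite.finite_basis b
  have := Fintype.ofFinite (Σ γ : ι → ℝ, Fin (Module.finrank ℝ ↥(⨅ j, (S j).eigenspace (γ j))))
  have hcard : Fintype.card (Σ γ : ι → ℝ,
      Fin (Module.finrank ℝ ↥(⨅ j, (S j).eigenspace (γ j)))) = Fintype.card (Fin n) := by
    rw [← Module.finrank_eq_card_basis b, hn, Fintype.card_fin]
  refine ⟨(b.toOrthonormalBasis hb).reindex (Fintype.equivOfCardEq hcard), fun i k => ?_⟩
  obtain ⟨⟨γ, l⟩, rfl⟩ := (Fintype.equivOfCardEq hcard).surjective k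
  refine ⟨γ i, ?_⟩
  have hmem := hint.collectedBasis_mem (fun γ => (v γ).toBasis) ⟨γ, l⟩
  have := (Submodule.mem_iInf _).1 hmem i
  rw [OrthonormalBasis.reindex_apply, Equiv.symm_apply_apply, Module.Basis.coe_toOrthonormalBasis]
  exact Module.End.mem_eigenspace_iff.1 this

/-- A symmetric bilinear form with values in `N` whose components in `N` commute is diagonal in
an orthonormal basis, with principal normals `l k`. -/
theorem exists_orthonormalBasis_diagonalizing {E H : Type*} [NormedAddCommGroup E]
    [InnerProductSpace ℝ E] [FiniteDimensional ℝ E] [NormedAddCommGroup H]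
    [InnerProductSpace ℝ H] {n : ℕ} (hn : Module.finrank ℝ E = n) (N : Submodule ℝ H)
    {B : E → E → H} (hBN : ∀ U V, B U V ∈ N) (hsymm : ∀ U V, B U V = B V U)
    {S : N → Module.End ℝ E}
    (hS : ∀ (ζ : N) U V, inner ℝ (S ζ U) V = inner ℝ (B U V) (ζ : H))
    (hc : ∀ (ζ ξ : N) U V, inner ℝ (S ζ U) (S ξ V) = inner ℝ (S ζ V) (S ξ U)) :
    ∃ (e : OrthonormalBasis (Fin n) ℝ E) (l : Fin n → N),
      ∀ k V, B (e k) V = inner ℝ (e k) V • (l k : H) := by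
  have hsym : ∀ ζ, (S ζ).IsSymmetric := fun ζ U V => by
    rw [hS, hsymm, ← hS, real_inner_comm]
  have hcomm : ∀ ζ ξ, Commute (S ζ) (S ξ) := fun ζ ξ => by
    refine LinearMap.ext fun U => ext_inner_right ℝ fun V => ?_
    change inner ℝ (S ζ (S ξ U)) V = inner ℝ (S ξ (S ζ U)) V
    rw [hsym ζ (S ξ U) V, hsym ξ (S ζ U) V, hc ζ ξ U V, real_inner_comm]
  obtain ⟨e, he⟩ := exists_orthonormalBasis_joint_eigenvectors hn hsym hcomm
  refine ⟨e, fun k => ⟨B (e k) (e k), hBN _ _⟩, fun k V => ?_⟩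
  have hmem : B (e k) V - inner ℝ (e k) V • B (e k) (e k) ∈ N :=
    N.sub_mem (hBN _ _) (N.smul_mem _ (hBN _ _))
  rw [← sub_eq_zero, ← inner_self_eq_zero (𝕜 := ℝ)]
  obtain ⟨c, hck⟩ := he ⟨_, hmem⟩ k
  have h1 := hS ⟨_, hmem⟩ (e k) V
  have h2 := hS ⟨_, hmem⟩ (e k) (e k)
  rw [hck, real_inner_smul_left] at h1 h2
  have h3 : inner ℝ (e k) (e k) = (1 : ℝ) := by
    rw [real_inner_self_eq_norm_sq, e.orthonormal.1 k]; norm_num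
  rw [h3, mul_one] at h2
  rw [inner_sub_left, real_inner_smul_left]
  simp only at h1 h2
  rw [← h1, ← h2]
  ring

/-- The linear algebra behind quasiumbilicity. If the products of the vectors `l i` satisfy the
relation `⟨l i, l j⟩ = s i + s j` and at least two of them equal `η`, then the differences
`l i - η` are pairwise orthogonal. Normalizing those that do not vanish and completing to an
orthonormal basis gives a basis each of whose members is orthogonal to all but at most one of the
differences. -/
theorem exists_orthonormalBasis_of_inner_eq_add {N : Type*} [NormedAddCommGroup N]
    [InnerProductSpace ℝ N] [FiniteDimensional ℝ N] {n p m : ℕ} (hN : Module.finrank ℝ N = p)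
    (l : Fin n → N) (η : N) (s : Fin n → ℝ)
    (hl : ∀ i j, i ≠ j → inner ℝ (l i) (l j) = s i + s j)
    (hm : 2 ≤ m) (hcard : Nat.card {i // l i = η} = m) :
    n ≤ p + m ∧ ∃ b : OrthonormalBasis (Fin p) ℝ N, ∀ j, ∃ i₀, ∀ i, i ≠ i₀ →
      inner ℝ (l i) (b j) = inner ℝ η (b j) := by
  classical
  rw [Nat.card_eq_fintype_card] at hcard
  have horth : ∀ i j, i ≠ j → inner ℝ (l i - η) (l j - η) = 0 := by
    intro i j hij
    by_cases hi : l i = η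
    · simp [hi]
    by_cases hj : l j = η
    · simp [hj]
    obtain ⟨⟨a, ha⟩, ⟨b, hb⟩, hab⟩ :=
      Fintype.one_lt_card_iff.1 (by omega : 1 < Fintype.card {i // l i = η})
    have hab' : a ≠ b := fun h => hab (Subtype.ext h)
    have hia : i ≠ a := fun h => hi (h ▸ ha)
    have hbj : b ≠ j := fun h => hj (h ▸ hb)
    have h1 := hl i j hij
    have h2 := hl i a hia
    have h3 := hl b j hbj
    have h4 := hl a b hab'
    rw [ha] at h2 h4
    rw [hb] at h3 h4
    rw [inner_sub_left, inner_sub_right, inner_sub_right]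
    linarith
  let u : {i // l i ≠ η} → N := fun i => ‖l i - η‖⁻¹ • (l i - η)
  have hne : ∀ i : {i // l i ≠ η}, ‖l i - η‖ ≠ 0 := fun i =>
    norm_ne_zero_iff.2 (sub_ne_zero.2 i.2)
  have hu : Orthonormal ℝ u := by
    refine ⟨fun i => ?_, fun i j hij => ?_⟩
    · simp only [u, norm_smul, norm_inv, norm_norm]
      exact inv_mul_cancel₀ (hne i)
    · simp only [u, real_inner_smul_left, real_inner_smul_right]
      rw [horth i j fun h => hij (Subtype.ext h)]
      simp
  refine ⟨?_, ?_⟩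
  · have h1 := hu.linearIndependent.fintype_card_le_finrank
    rw [hN, Fintype.card_subtype_compl, hcard, Fintype.card_fin] at h1
    omega
  · obtain ⟨w, b, hw, hb⟩ := hu.toSubtypeRange.exists_orthonormalBasis_extension
    have hwc : Fintype.card w = Fintype.card (Fin p) := by
      rw [← Module.finrank_eq_card_basis b.toBasis, hN, Fintype.card_fin]
    refine ⟨b.reindex (Fintype.equivOfCardEq hwc), fun j => ?_⟩
    rw [OrthonormalBasis.reindex_apply]
    set k := (Fintype.equivOfCardEq hwc).symm j
    have hz : ∀ i (hi : l i ≠ η), b k ≠ u ⟨i, hi⟩ →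
        inner ℝ (l i) (b k) = inner ℝ η (b k) := by
      intro i hi hik
      have hmem : u ⟨i, hi⟩ ∈ w := hw ⟨_, rfl⟩
      have hbi : b ⟨_, hmem⟩ = u ⟨i, hi⟩ := by rw [hb]
      have hk : (⟨_, hmem⟩ : w) ≠ k := fun h => hik (by rw [← hbi, h])
      have h0 : inner ℝ (b ⟨_, hmem⟩) (b k) = 0 := b.orthonormal.2 hk
      rw [hbi] at h0
      simp only [u, real_inner_smul_left, mul_eq_zero, inv_eq_zero, hne ⟨i, hi⟩, false_or] at h0
      rw [inner_sub_left] at h0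
      linarith
    by_cases hex : ∃ i : {i // l i ≠ η}, b k = u i
    · obtain ⟨i₀, hi₀⟩ := hex
      refine ⟨i₀, fun i hi => ?_⟩
      by_cases h : l i = η
      · rw [h]
      · refine hz i h fun h' => hi ?_
        have := hu.linearIndependent.injective (h'.symm.trans hi₀)
        rw [← this]
    · obtain ⟨a⟩ : Nonempty {i // l i = η} := Fintype.card_pos_iff.1 (by omega)
      refine ⟨a, fun i _ => ?_⟩
      by_cases h : l i = η
      · rw [h]
      · exact hz i h fun h' => hex ⟨_, h'⟩

/-- The subspace `E_η` of a diagonal form is spanned by the basis vectors with principal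
normal `η`. -/
theorem card_eq_finrank_of_diagonal {E H : Type*} [NormedAddCommGroup E]
    [InnerProductSpace ℝ E] [NormedAddCommGroup H] [InnerProductSpace ℝ H] {n : ℕ}
    {B : E → E → H} (hsymm : ∀ U V, B U V = B V U) (e : OrthonormalBasis (Fin n) ℝ E)
    (l : Fin n → H) (he : ∀ k V, B (e k) V = inner ℝ (e k) V • l k) (η : H)
    {K : Submodule ℝ E} (hK : ∀ U, U ∈ K ↔ ∀ V, B U V = inner ℝ U V • η) :
    Nat.card {i // l i = η} = Module.finrank ℝ K := by
  classical
  have hspan : K = Submodule.span ℝ (Set.range fun i : {i // l i = η} => e i) := by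
    apply le_antisymm
    · intro U hU
      rw [← e.sum_repr U]
      refine Submodule.sum_mem _ fun i _ => ?_
      by_cases hi : l i = η
      · exact Submodule.smul_mem _ _ (Submodule.subset_span ⟨⟨i, hi⟩, rfl⟩)
      · have h := (hK U).1 hU (e i)
        rw [hsymm, he, real_inner_comm, ← sub_eq_zero, ← smul_sub, smul_eq_zero] at h
        rw [e.repr_apply_apply, real_inner_comm, h.resolve_right (sub_ne_zero.2 hi), zero_smul]
        exact Submodule.zero_mem _
    · rw [Submodule.span_le]
      rintro _ ⟨⟨i, hi⟩, rfl⟩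
      exact (hK _).2 fun V => by rw [he, hi]
  have hli : LinearIndependent ℝ fun i : {i // l i = η} => e i :=
    e.orthonormal.linearIndependent.comp _ Subtype.val_injective
  rw [hspan, finrank_span_eq_card hli, Nat.card_eq_fintype_card]

/-! ### The Ricci equation -/

open Filter Topology in
/-- The Ricci equation. `P y` is the orthogonal projection onto the normal space `K y` of an
immersion `h`. For the normal field `y ↦ P y ξ` the normal curvature is
`P [∂_X P, ∂_Y P] ξ`, and `∂_Y P ξ` is the tangent vector `-h_* (A_ξ Y)`; hence the shape
operators `a` of `ξ` and `b` of `ζ` commute where the curvature vanishes. -/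
theorem inner_fderiv_shape_comm {E H : Type*}
    [NormedAddCommGroup E] [NormedSpace ℝ E] [FiniteDimensional ℝ E]
    [NormedAddCommGroup H] [InnerProductSpace ℝ H] [FiniteDimensional ℝ H]
    {h : E → H} {P : E → H →L[ℝ] H} {K : E → Submodule ℝ H} {y₀ : E}
    (hh : ContDiffAt ℝ 2 h y₀) (hP : ContDiffAt ℝ 2 P y₀)
    (hPK : ∀ᶠ y in 𝓝 y₀, P y = (K y).starProjection)
    (hKh : ∀ᶠ y in 𝓝 y₀, ∀ v ∈ K y, ∀ Z, inner ℝ v (fderiv ℝ h y Z) = 0)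
    (hK : K y₀ = (fderiv ℝ h y₀).rangeᗮ) {ξ ζ : H} (hξ : ξ ∈ K y₀) (hζ : ζ ∈ K y₀) {X Y : E}
    (hR : P y₀ (fderiv ℝ (fun y => P y (fderiv ℝ (fun z => P z ξ) y Y)) y₀ X) =
      P y₀ (fderiv ℝ (fun y => P y (fderiv ℝ (fun z => P z ξ) y X)) y₀ Y))
    {a b : E → E}
    (ha : ∀ V Z, inner ℝ (fderiv ℝ h y₀ (a V)) (fderiv ℝ h y₀ Z) =
      inner ℝ (fderiv ℝ (fderiv ℝ h) y₀ V Z) ξ)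
    (hb : ∀ V Z, inner ℝ (fderiv ℝ h y₀ (b V)) (fderiv ℝ h y₀ Z) =
      inner ℝ (fderiv ℝ (fderiv ℝ h) y₀ V Z) ζ) :
    inner ℝ (fderiv ℝ h y₀ (a X)) (fderiv ℝ h y₀ (b Y)) =
      inner ℝ (fderiv ℝ h y₀ (a Y)) (fderiv ℝ h y₀ (b X)) := by
  have hP1 : ContDiffAt ℝ 1 (fderiv ℝ P) y₀ := hP.fderiv_right (by norm_num)
  have dP : ∀ᶠ y in 𝓝 y₀, HasFDerivAt P (fderiv ℝ P y) y :=
    (hP.eventually (by simp)).mono fun y hy => (hy.differentiableAt (by norm_num)).hasFDerivAt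
  have ddP := (hP1.differentiableAt (by norm_num)).hasFDerivAt
  have dP₀ := dP.self_of_nhds
  have dPv : ∀ v, HasFDerivAt (fun y => P y v) ((fderiv ℝ P y₀).flip v) y₀ := fun v => by
    simpa using dP₀.clm_apply (hasFDerivAt_const v y₀)
  have hP₀ := hPK.self_of_nhds
  have hPv : ∀ v ∈ K y₀, P y₀ v = v := fun v hv => by
    rw [hP₀, Submodule.starProjection_eq_self_iff.2 hv]
  -- the derivative of `P` is symmetric
  have hsymm : ∀ V u v, inner ℝ (fderiv ℝ P y₀ V u) v = inner ℝ u (fderiv ℝ P y₀ V v) := by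
    intro V u v
    have h1 : (fun y => inner ℝ (P y u) v) =ᶠ[𝓝 y₀] fun y => inner ℝ u (P y v) := by
      filter_upwards [hPK] with y hy
      rw [hy, Submodule.inner_starProjection_left_eq_right]
    have h2 := congrArg (fun T : E →L[ℝ] ℝ => T V) h1.fderiv_eq
    rw [((dPv u).inner ℝ (hasFDerivAt_const v y₀)).fderiv,
      ((hasFDerivAt_const u y₀).inner ℝ (dPv v)).fderiv] at h2
    simpa using h2
  -- the derivative of `P` maps normal vectors to tangent vectors, because `P ∘ P = P`
  have htan : ∀ V, ∀ v ∈ K y₀, P y₀ (fderiv ℝ P y₀ V v) = 0 := by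
    intro V v hv
    have h1 : (fun y => P y (P y v)) =ᶠ[𝓝 y₀] fun y => P y v := by
      filter_upwards [hPK] with y hy
      rw [hy, Submodule.starProjection_eq_self_iff.2 (Submodule.starProjection_apply_mem _ _)]
    have h2 := congrArg (fun T : E →L[ℝ] H => T V) h1.fderiv_eq
    rw [(dP₀.clm_apply (dPv v)).fderiv, (dPv v).fderiv] at h2
    simpa [hPv v hv] using h2
  -- the Weingarten formula
  have hwein : ∀ V, ∀ v ∈ K y₀, ∀ c : E → E,
      (∀ V Z, inner ℝ (fderiv ℝ h y₀ (c V)) (fderiv ℝ h y₀ Z) =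
        inner ℝ (fderiv ℝ (fderiv ℝ h) y₀ V Z) v) →
      fderiv ℝ P y₀ V v = -fderiv ℝ h y₀ (c V) := by
    intro V v hv c hc
    have hd : HasFDerivAt (fderiv ℝ h) (fderiv ℝ (fderiv ℝ h) y₀) y₀ :=
      ((hh.fderiv_right (m := 1) (by norm_num)).differentiableAt (by norm_num)).hasFDerivAt
    have hpair : ∀ Z, inner ℝ (fderiv ℝ P y₀ V v) (fderiv ℝ h y₀ Z) =
        -inner ℝ (fderiv ℝ (fderiv ℝ h) y₀ V Z) v := by
      intro Z
      have dZ : HasFDerivAt (fun y => fderiv ℝ h y Z) ((fderiv ℝ (fderiv ℝ h) y₀).flip Z) y₀ := by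
        simpa using hd.clm_apply (hasFDerivAt_const Z y₀)
      have h1 : (fun y => inner ℝ (P y v) (fderiv ℝ h y Z)) =ᶠ[𝓝 y₀] fun _ => (0 : ℝ) := by
        filter_upwards [hPK, hKh] with y hy hy'
        exact hy' _ (hy ▸ Submodule.starProjection_apply_mem _ _) Z
      have h2 := congrArg (fun T : E →L[ℝ] ℝ => T V) h1.fderiv_eq
      rw [((dPv v).inner ℝ dZ).fderiv, (hasFDerivAt_const (0 : ℝ) y₀).fderiv] at h2
      simp only [ContinuousLinearMap.comp_apply, ContinuousLinearMap.prod_apply,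
        fderivInnerCLM_apply, ContinuousLinearMap.flip_apply, zero_apply,
        hPv v hv] at h2
      rw [real_inner_comm v]
      linarith
    have hmem : fderiv ℝ P y₀ V v ∈ (fderiv ℝ h y₀).range := by
      have h1 := htan V v hv
      rw [hP₀, Submodule.starProjection_apply_eq_zero_iff, hK,
        Submodule.orthogonal_orthogonal] at h1
      exact h1
    obtain ⟨w, hw⟩ := hmem
    have hw' : fderiv ℝ h y₀ w = fderiv ℝ P y₀ V v := hw
    have h0 : inner ℝ (fderiv ℝ h y₀ w + fderiv ℝ h y₀ (c V)) (fderiv ℝ h y₀ (w + c V)) = 0 := by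
      rw [inner_add_left, hc, hw', hpair]
      ring
    rw [map_add, inner_self_eq_zero, hw'] at h0
    exact eq_neg_of_add_eq_zero_left h0
  -- the curvature of the projected field, in terms of the derivative of `P`
  have hcurv : ∀ V W, fderiv ℝ (fun y => P y (fderiv ℝ (fun z => P z ξ) y W)) y₀ V =
      fderiv ℝ P y₀ V (fderiv ℝ P y₀ W ξ) + P y₀ (fderiv ℝ (fderiv ℝ P) y₀ V W ξ) := by
    intro V W
    have h1 : (fun y => P y (fderiv ℝ (fun z => P z ξ) y W)) =ᶠ[𝓝 y₀]
        fun y => P y (fderiv ℝ P y W ξ) := by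
      filter_upwards [dP] with y hy
      rw [(hy.clm_apply (hasFDerivAt_const ξ y)).fderiv]
      simp
    have h2 : HasFDerivAt (fun y => fderiv ℝ P y W ξ)
        (((fderiv ℝ (fderiv ℝ P) y₀).flip W).flip ξ) y₀ := by
      have h3 : HasFDerivAt (fun y => fderiv ℝ P y W) ((fderiv ℝ (fderiv ℝ P) y₀).flip W) y₀ := by
        simpa using ddP.clm_apply (hasFDerivAt_const W y₀)
      simpa using h3.clm_apply (hasFDerivAt_const ξ y₀)
    rw [h1.fderiv_eq, (dP₀.clm_apply h2).fderiv]
    simp [add_comm]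
  rw [hcurv, hcurv, (hP.isSymmSndFDerivAt (by simp) : IsSymmSndFDerivAt ℝ P y₀) X Y] at hR
  have h1 := congrArg (fun v => inner ℝ v ζ) hR
  simp only [map_add, inner_add_left, add_left_inj] at h1
  have hPζ : ∀ v, inner ℝ (P y₀ v) ζ = inner ℝ v ζ := fun v => by
    rw [hP₀, Submodule.inner_starProjection_left_eq_right, ← hP₀, hPv ζ hζ]
  rw [hPζ, hPζ, hsymm X _ ζ, hsymm Y _ ζ, hwein X ξ hξ a ha, hwein Y ξ hξ a ha, hwein X ζ hζ b hb,
    hwein Y ζ hζ b hb, inner_neg_neg, inner_neg_neg] at h1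
  exact h1.symm

/-! ### Shape operators in the preferred chart -/

namespace EuclideanSubmanifold

open Filter Topology

variable {n N : ℕ} {M : Type*} [TopologicalSpace M] [ChartedSpace (Euc n) M]

theorem extChartAt_symm_chartPoint (x : M) :
    (extChartAt 𝓘(ℝ, Euc n) x).symm (chartPoint n x) = x :=
  extChartAt_to_inv x

theorem tendsto_extChartAt_symm (x : M) :
    Tendsto (extChartAt 𝓘(ℝ, Euc n) x).symm (𝓝 (chartPoint n x)) (𝓝 x) := by
  have := continuousAt_extChartAt_symm (I := 𝓘(ℝ, Euc n)) x
  rwa [ContinuousAt, extChartAt_to_inv x] at this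

theorem differential_eq_fderiv_inChart {f : M → Euc N} {x : M}
    (hf : MDifferentiableAt 𝓘(ℝ, Euc n) 𝓘(ℝ, Euc N) f x) :
    differential n f x = fderiv ℝ (inChart n f x) (chartPoint n x) := by
  unfold differential
  rw [hf.mfderiv]
  simp only [modelWithCornersSelf_coe, Set.range_id, fderivWithin_univ]
  rfl

theorem normalSpace_eq_of_mdifferentiableAt {f : M → Euc N} {x : M}
    (hf : MDifferentiableAt 𝓘(ℝ, Euc n) 𝓘(ℝ, Euc N) f x) :
    normalSpace n f x = (fderiv ℝ (inChart n f x) (chartPoint n x)).rangeᗮ :=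
  congrArg (fun T : Euc n →L[ℝ] Euc N => T.rangeᗮ) (differential_eq_fderiv_inChart hf)

variable [IsManifold 𝓘(ℝ, Euc n) ∞ M]

theorem contMDiffAt_extChartAt_symm_self (x : M) :
    ContMDiffAt 𝓘(ℝ, Euc n) 𝓘(ℝ, Euc n) ∞ (extChartAt 𝓘(ℝ, Euc n) x).symm (chartPoint n x) :=
  (contMDiffOn_extChartAt_symm x).contMDiffAt (extChartAt_target_mem_nhds x)

theorem contDiffAt_inChart {F : Type*} [NormedAddCommGroup F] [NormedSpace ℝ F] {h : M → F}
    {x : M} (hh : ContMDiffAt 𝓘(ℝ, Euc n) 𝓘(ℝ, F) ∞ h x) :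
    ContDiffAt ℝ ∞ (inChart n h x) (chartPoint n x) := by
  rw [← contMDiffAt_iff_contDiffAt]
  have h1 := contMDiffAt_extChartAt_symm_self (n := n) x
  rw [← extChartAt_symm_chartPoint (n := n) x] at hh
  exact hh.comp _ h1

theorem fderiv_inChart_mem_range {f : M → Euc N}
    (hf : ContMDiff 𝓘(ℝ, Euc n) 𝓘(ℝ, Euc N) ∞ f) (x : M) :
    ∀ᶠ y in 𝓝 (chartPoint n x), ∀ Z, fderiv ℝ (inChart n f x) y Z ∈
      (differential n f ((extChartAt 𝓘(ℝ, Euc n) x).symm y)).range := by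
  filter_upwards [extChartAt_target_mem_nhds (I := 𝓘(ℝ, Euc n)) x] with y hy Z
  have h1 : MDifferentiableAt 𝓘(ℝ, Euc n) 𝓘(ℝ, Euc n) (extChartAt 𝓘(ℝ, Euc n) x).symm y :=
    ((contMDiffOn_extChartAt_symm (n := ∞) x).contMDiffAt
      ((isOpen_extChartAt_target x).mem_nhds hy)).mdifferentiableAt (by simp)
  have h2 := mfderiv_comp y ((hf _).mdifferentiableAt (by simp)) h1
  refine ⟨mfderiv 𝓘(ℝ, Euc n) 𝓘(ℝ, Euc n) (extChartAt 𝓘(ℝ, Euc n) x).symm y Z, ?_⟩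
  have h3 : fderiv ℝ (inChart n f x) y = mfderiv 𝓘(ℝ, Euc n) 𝓘(ℝ, Euc N)
      (f ∘ (extChartAt 𝓘(ℝ, Euc n) x).symm) y := mfderiv_eq_fderiv.symm
  rw [h3, h2]
  rfl

/-- The Ricci equation on the manifold: shape operators commute where the normal bundle is flat.
The normal projection is assumed to be smooth near the point; it serves to extend normal
vectors to normal fields. -/
theorem shapeOperator_comm {g : Metric n M} {f : M → Euc N} (hf : IsIsometricImmersion n g f)
    (hflat : HasFlatNormalBundle n f) {x : M} {U : Set M} (hU : IsOpen U) (hx : x ∈ U)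
    {Q : M → Euc N →L[ℝ] Euc N}
    (hQ : ContMDiffOn 𝓘(ℝ, Euc n) 𝓘(ℝ, Euc N →L[ℝ] Euc N) ∞ Q U)
    (hQU : ∀ y ∈ U, Q y = (normalSpace n f y).starProjection) {ξ ζ : Euc N}
    (hξ : ξ ∈ normalSpace n f x) (hζ : ζ ∈ normalSpace n f x) (X Y : Tan n x) :
    g.inner x (shapeOperator n g f x ξ X) (shapeOperator n g f x ζ Y) =
      g.inner x (shapeOperator n g f x ξ Y) (shapeOperator n g f x ζ X) := by
  have hfx : MDifferentiableAt 𝓘(ℝ, Euc n) 𝓘(ℝ, Euc N) f x := (hf.1 x).mdifferentiableAt (by simp)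
  have hD := differential_eq_fderiv_inChart hfx
  have hN := normalSpace_eq_of_mdifferentiableAt hfx
  have hUy : ∀ᶠ y in 𝓝 (chartPoint n x), (extChartAt 𝓘(ℝ, Euc n) x).symm y ∈ U :=
    (tendsto_extChartAt_symm x).eventually (hU.mem_nhds hx)
  have hPK : ∀ᶠ y in 𝓝 (chartPoint n x),
      inChart n Q x y = (inChart n (normalSpace n f) x y).starProjection :=
    hUy.mono fun y hy => hQU _ hy
  have hKx : inChart n (normalSpace n f) x (chartPoint n x) = normalSpace n f x := by
    unfold inChart; rw [extChartAt_symm_chartPoint]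
  have hpair : ∀ v ∈ normalSpace n f x, ∀ V Z : Tan n x,
      inner ℝ (fderiv ℝ (inChart n f x) (chartPoint n x) (shapeOperator n g f x v V))
        (fderiv ℝ (inChart n f x) (chartPoint n x) Z) =
      inner ℝ (fderiv ℝ (fderiv ℝ (inChart n f x)) (chartPoint n x) V Z) v := by
    intro v hv V Z
    rw [← hD]
    have h1 := hf.2 x (shapeOperator n g f x v V) Z
    refine h1.trans ((inner_shapeOperator n g f x v V Z).trans ?_)
    unfold secondFundamentalForm
    rw [Submodule.inner_starProjection_left_eq_right, Submodule.starProjection_eq_self_iff.2 hv]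
  have hξN : IsNormalFieldOn n f (fun y => Q y ξ) U := by
    refine ⟨hQ.clm_apply contMDiffOn_const, fun y hy => ?_⟩
    simp only [hQU y hy]
    exact Submodule.starProjection_apply_mem _ _
  have hR := hflat x U _ hU hx hξN X Y
  have hnd : ∀ V W : Euc n, normalDeriv n f x V
      (normalDeriv n f x W (inChart n (fun y => Q y ξ) x)) (chartPoint n x) =
      inChart n Q x (chartPoint n x) (fderiv ℝ (fun y => inChart n Q x y
        (fderiv ℝ (fun z => inChart n Q x z ξ) y W)) (chartPoint n x) V) := by
    intro V W
    have h1 : normalDeriv n f x W (inChart n (fun y => Q y ξ) x) =ᶠ[𝓝 (chartPoint n x)]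
        fun y => inChart n Q x y (fderiv ℝ (fun z => inChart n Q x z ξ) y W) := by
      filter_upwards [hPK] with y hy
      rw [hy]
      rfl
    rw [normalDeriv, h1.fderiv_eq, hPK.self_of_nhds]
  have hR' := ((hnd X Y).symm.trans (sub_eq_zero.1 hR)).trans (hnd Y X)
  have := inner_fderiv_shape_comm (h := inChart n f x) (P := inChart n Q x)
    (K := inChart n (normalSpace n f) x) (y₀ := chartPoint n x)
    ((contDiffAt_inChart (hf.1 x)).of_le ENat.LEInfty.out)
    ((contDiffAt_inChart (hQ.contMDiffAt (hU.mem_nhds hx))).of_le ENat.LEInfty.out) hPK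
    ((fderiv_inChart_mem_range hf.1 x).mono fun y hy v hv Z =>
      Submodule.inner_left_of_mem_orthogonal (hy Z) hv) (hKx.trans hN)
    (hKx ▸ hξ) (hKx ▸ hζ) hR' (hpair ξ hξ) (hpair ζ hζ)
  rw [← hD] at this
  exact (hf.2 x _ _).symm.trans (this.trans (hf.2 x _ _))

end EuclideanSubmanifold

/-! ### Conformal charts -/

namespace EuclideanSubmanifold

open Filter Topology

variable {n N : ℕ} {M : Type*} [TopologicalSpace M] [ChartedSpace (Euc n) M]
  [IsManifold 𝓘(ℝ, Euc n) ∞ M]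

/-- `φ` is a conformal diffeomorphism of an open subset of `(M, g)` onto an open subset of `ℝⁿ`,
with conformal factor `lam`. -/
structure IsConformalChart (g : Metric n M) (φ : OpenPartialHomeomorph M (Euc n))
    (lam : M → ℝ) : Prop where
  contMDiffOn : ContMDiffOn 𝓘(ℝ, Euc n) 𝓘(ℝ, Euc n) ∞ φ φ.source
  contMDiffOn_symm : ContMDiffOn 𝓘(ℝ, Euc n) 𝓘(ℝ, Euc n) ∞ φ.symm φ.target
  contMDiffOn_factor : ContMDiffOn 𝓘(ℝ, Euc n) 𝓘(ℝ, ℝ) ∞ lam φ.source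
  pos : ∀ y ∈ φ.source, 0 < lam y
  inner_eq : ∀ y ∈ φ.source, ∀ X Y : Tan n y,
    inner ℝ (differential n φ y X) (differential n φ y Y) = lam y ^ 2 * g.inner y X Y

variable {g : Metric n M} {φ : OpenPartialHomeomorph M (Euc n)} {lam : M → ℝ} {f : M → Euc N}
  {z : Euc n}

theorem IsConformalChart.contMDiffAt_symm (hφ : IsConformalChart g φ lam) (hz : z ∈ φ.target) :
    ContMDiffAt 𝓘(ℝ, Euc n) 𝓘(ℝ, Euc n) ∞ φ.symm z :=
  hφ.contMDiffOn_symm.contMDiffAt (φ.open_target.mem_nhds hz)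

theorem IsConformalChart.contDiffAt_comp (hφ : IsConformalChart g φ lam)
    (hf : ContMDiff 𝓘(ℝ, Euc n) 𝓘(ℝ, Euc N) ∞ f) (hz : z ∈ φ.target) :
    ContDiffAt ℝ ∞ (f ∘ φ.symm) z :=
  contMDiffAt_iff_contDiffAt.1 ((hf _).comp z (hφ.contMDiffAt_symm hz))

theorem IsConformalChart.contDiffAt_factor (hφ : IsConformalChart g φ lam) (hz : z ∈ φ.target) :
    ContDiffAt ℝ ∞ (fun z => (lam (φ.symm z) ^ 2)⁻¹) z := by
  have h1 : ContDiffAt ℝ ∞ (lam ∘ φ.symm) z := contMDiffAt_iff_contDiffAt.1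
    ((hφ.contMDiffOn_factor.contMDiffAt (φ.open_source.mem_nhds (φ.map_target hz))).comp z
      (hφ.contMDiffAt_symm hz))
  exact (h1.pow 2).inv (pow_ne_zero 2 (hφ.pos _ (φ.map_target hz)).ne')

theorem IsConformalChart.fderiv_comp_apply (hφ : IsConformalChart g φ lam)
    (hf : ContMDiff 𝓘(ℝ, Euc n) 𝓘(ℝ, Euc N) ∞ f) (hz : z ∈ φ.target) (U : Euc n) :
    fderiv ℝ (f ∘ φ.symm) z U = differential n f (φ.symm z)
      (mfderiv 𝓘(ℝ, Euc n) 𝓘(ℝ, Euc n) φ.symm z U) := by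
  have h2 := mfderiv_comp z ((hf _).mdifferentiableAt (by simp))
    ((hφ.contMDiffAt_symm hz).mdifferentiableAt (by simp))
  have h3 : fderiv ℝ (f ∘ φ.symm) z = mfderiv 𝓘(ℝ, Euc n) 𝓘(ℝ, Euc N) (f ∘ φ.symm) z :=
    mfderiv_eq_fderiv.symm
  rw [h3, h2]
  rfl

theorem IsConformalChart.differential_mfderiv_symm (hφ : IsConformalChart g φ lam)
    (hz : z ∈ φ.target) (U : Euc n) :
    differential n φ (φ.symm z) (mfderiv 𝓘(ℝ, Euc n) 𝓘(ℝ, Euc n) φ.symm z U) = U := by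
  have h2 := mfderiv_comp z
    ((hφ.contMDiffOn.contMDiffAt
      (φ.open_source.mem_nhds (φ.map_target hz))).mdifferentiableAt (by simp))
    ((hφ.contMDiffAt_symm hz).mdifferentiableAt (by simp))
  have h3 : φ ∘ φ.symm =ᶠ[𝓝 z] id := by
    filter_upwards [φ.open_target.mem_nhds hz] with y hy using φ.right_inv hy
  have h4 : mfderiv 𝓘(ℝ, Euc n) 𝓘(ℝ, Euc n) (φ ∘ φ.symm) z U = U := by
    rw [mfderiv_eq_fderiv, h3.fderiv_eq, fderiv_id]
    rfl
  rw [h2] at h4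
  exact h4

/-- In a conformal chart, an isometric immersion becomes a conformal immersion of an open subset
of `ℝⁿ`. -/
theorem IsConformalChart.inner_fderiv_comp (hφ : IsConformalChart g φ lam)
    (hf : IsIsometricImmersion n g f) (hz : z ∈ φ.target) (U V : Euc n) :
    inner ℝ (fderiv ℝ (f ∘ φ.symm) z U) (fderiv ℝ (f ∘ φ.symm) z V) =
      (lam (φ.symm z) ^ 2)⁻¹ * inner ℝ U V := by
  have hpos := hφ.pos _ (φ.map_target hz)
  have h1 := hφ.inner_eq _ (φ.map_target hz)
    (mfderiv 𝓘(ℝ, Euc n) 𝓘(ℝ, Euc n) φ.symm z U) (mfderiv 𝓘(ℝ, Euc n) 𝓘(ℝ, Euc n) φ.symm z V)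
  rw [hφ.differential_mfderiv_symm hz, hφ.differential_mfderiv_symm hz] at h1
  rw [hφ.fderiv_comp_apply hf.1 hz, hφ.fderiv_comp_apply hf.1 hz, hf.2, h1]
  field_simp

theorem IsConformalChart.normalSpace_symm (hφ : IsConformalChart g φ lam)
    (hf : ContMDiff 𝓘(ℝ, Euc n) 𝓘(ℝ, Euc N) ∞ f) (hz : z ∈ φ.target) :
    normalSpace n f (φ.symm z) = (fderiv ℝ (f ∘ φ.symm) z).rangeᗮ := by
  let T : Euc n →L[ℝ] Euc n := mfderiv 𝓘(ℝ, Euc n) 𝓘(ℝ, Euc n) φ.symm z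
  have hinj : Function.Injective T.toLinearMap :=
    Function.LeftInverse.injective (g := differential n φ (φ.symm z))
      (hφ.differential_mfderiv_symm hz)
  have hsurj := LinearMap.injective_iff_surjective.1 hinj
  unfold normalSpace
  congr 1
  ext v
  constructor
  · rintro ⟨X, rfl⟩
    obtain ⟨U, hU⟩ := hsurj X
    exact ⟨U, (hφ.fderiv_comp_apply hf hz U).trans (congrArg (differential n f (φ.symm z)) hU)⟩
  · rintro ⟨U, rfl⟩
    exact ⟨_, (hφ.fderiv_comp_apply hf hz U).symm⟩

/-- In a conformal chart, the partial derivatives `F_i` of the immersion are an orthogonal frame of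
constant length, so that the normal projection is `v - ρ⁻¹ ∑ ⟨v, F_i⟩ F_i`; in particular it
is smooth. -/
theorem IsConformalChart.exists_smooth_normalProjection (hφ : IsConformalChart g φ lam)
    (hf : IsIsometricImmersion n g f) :
    ∃ Q : M → Euc N →L[ℝ] Euc N,
      ContMDiffOn 𝓘(ℝ, Euc n) 𝓘(ℝ, Euc N →L[ℝ] Euc N) ∞ Q φ.source ∧
      ∀ y ∈ φ.source, Q y = (normalSpace n f y).starProjection := by
  let D : Euc n → Fin n → Euc N := fun z i =>
    fderiv ℝ (f ∘ φ.symm) z (EuclideanSpace.basisFun (Fin n) ℝ i)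
  let R : Euc n → Euc N →L[ℝ] Euc N := fun z => ContinuousLinearMap.id ℝ _ -
    ((lam (φ.symm z) ^ 2)⁻¹)⁻¹ • ∑ i, (innerSL ℝ (D z i)).smulRight (D z i)
  have hRs : ∀ z ∈ φ.target, ContDiffAt ℝ ∞ R z := by
    intro z hz
    have hD : ∀ i, ContDiffAt ℝ ∞ (fun z => D z i) z := fun i =>
      ((hφ.contDiffAt_comp hf.1 hz).fderiv_right (m := ∞) (by simp)).clm_apply contDiffAt_const
    refine contDiffAt_const.sub (ContDiffAt.smul ((hφ.contDiffAt_factor hz).inv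
      (inv_ne_zero (pow_ne_zero 2 (hφ.pos _ (φ.map_target hz)).ne'))) (ContDiffAt.sum fun i _ => ?_))
    exact ((innerSL ℝ (E := Euc N)).contDiff.contDiffAt.comp z (hD i)).smulRight (hD i)
  have hRp : ∀ z ∈ φ.target, R z = (fderiv ℝ (f ∘ φ.symm) z).rangeᗮ.starProjection := by
    intro z hz
    ext1 v
    have hsum : ∀ W : Euc n, ∑ i, inner ℝ (EuclideanSpace.basisFun (Fin n) ℝ i) W •
        EuclideanSpace.basisFun (Fin n) ℝ i = W := fun W =>
      (EuclideanSpace.basisFun (Fin n) ℝ).sum_repr' W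
    rw [starProjection_range_of_conformal (inv_pos.2 (pow_pos (hφ.pos _ (φ.map_target hz)) 2))
      (hφ.inner_fderiv_comp hf hz) (v := v)
      (a := ∑ i, inner ℝ v (D z i) • EuclideanSpace.basisFun (Fin n) ℝ i)]
    · simp [R, D, map_sum, real_inner_comm]
    · intro W
      conv_lhs => rw [← hsum W]
      simp [map_sum, inner_sum, sum_inner, real_inner_smul_left, real_inner_smul_right, D, mul_comm]
  refine ⟨fun y => R (φ y), fun y hy => ?_, fun y hy => ?_⟩
  · have h1 : ContMDiffAt 𝓘(ℝ, Euc n) 𝓘(ℝ, Euc N →L[ℝ] Euc N) ∞ R (φ y) :=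
      contMDiffAt_iff_contDiffAt.2 (hRs _ (φ.map_source hy))
    exact (h1.comp y (hφ.contMDiffOn.contMDiffAt
      (φ.open_source.mem_nhds hy))).contMDiffWithinAt
  · change R (φ y) = _
    simp only [hRp _ (φ.map_source hy), ← hφ.normalSpace_symm hf.1 (φ.map_source hy),
      φ.left_inv hy]

/-- The second fundamental form in a conformal chart. It is invariant under the change from
the preferred chart at `x`, as the additional second derivative of the transition map is
mapped to a tangent vector. -/
theorem IsConformalChart.exists_linearEquiv (hφ : IsConformalChart g φ lam)
    (hf : IsIsometricImmersion n g f) {x : M} (hx : x ∈ φ.source) :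
    ∃ L : Euc n ≃ₗ[ℝ] Tan n x,
      (∀ U V, g.inner x (L U) (L V) = (lam x ^ 2)⁻¹ * inner ℝ U V) ∧
      ∀ U V, secondFundamentalForm n f x (L U) (L V) = (normalSpace n f x).starProjection
        (fderiv ℝ (fderiv ℝ (f ∘ φ.symm)) (φ x) U V) := by
  have hz := φ.map_source hx
  have hpos : 0 < (lam x ^ 2)⁻¹ := inv_pos.2 (pow_pos (hφ.pos _ hx) 2)
  have hfx : MDifferentiableAt 𝓘(ℝ, Euc n) 𝓘(ℝ, Euc N) f x := (hf.1 x).mdifferentiableAt (by simp)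
  have hD := differential_eq_fderiv_inChart hfx
  let G : Euc n → Euc n := extChartAt 𝓘(ℝ, Euc n) x ∘ φ.symm
  have hGz : G (φ x) = chartPoint n x := by
    simp only [G, Function.comp_apply, φ.left_inv hx]; rfl
  have hG : ContDiffAt ℝ ∞ G (φ x) := by
    refine contMDiffAt_iff_contDiffAt.1 (ContMDiffAt.comp (φ x) ?_ (hφ.contMDiffAt_symm hz))
    rw [φ.left_inv hx]
    exact contMDiffAt_extChartAt
  have hh : ContDiffAt ℝ ∞ (inChart n f x) (G (φ x)) := hGz ▸ contDiffAt_inChart (hf.1 x)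
  have hFG : f ∘ φ.symm =ᶠ[𝓝 (φ x)] inChart n f x ∘ G := by
    have h1 : ∀ᶠ z in 𝓝 (φ x), φ.symm z ∈ (extChartAt 𝓘(ℝ, Euc n) x).source := by
      refine (φ.continuousAt_symm hz).eventually ?_
      rw [φ.left_inv hx]
      exact extChartAt_source_mem_nhds x
    filter_upwards [h1] with z hz
    simp only [Function.comp_apply, inChart, G, (extChartAt 𝓘(ℝ, Euc n) x).left_inv hz]
  -- the chain rule for the first and second derivatives
  have hdF : fderiv ℝ (f ∘ φ.symm) =ᶠ[𝓝 (φ x)]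
      fun z => (fderiv ℝ (inChart n f x) (G z)).comp (fderiv ℝ G z) := by
    have h1 : ∀ᶠ z in 𝓝 (φ x), DifferentiableAt ℝ (inChart n f x) (G z) :=
      hG.continuousAt.eventually (((hh.of_le (m := 1) (by simp)).eventually (by simp)).mono
        fun y hy => hy.differentiableAt (by simp))
    have h2 : ∀ᶠ z in 𝓝 (φ x), DifferentiableAt ℝ G z :=
      ((hG.of_le (m := 1) (by simp)).eventually (by simp)).mono
        fun y hy => hy.differentiableAt (by simp)
    filter_upwards [hFG.eventuallyEq_nhds, h1, h2] with z h0 h1 h2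
    rw [h0.fderiv_eq, fderiv_comp z h1 h2]
  have hddF : ∀ U V, fderiv ℝ (fderiv ℝ (f ∘ φ.symm)) (φ x) U V =
      fderiv ℝ (fderiv ℝ (inChart n f x)) (chartPoint n x) (fderiv ℝ G (φ x) U)
        (fderiv ℝ G (φ x) V) +
      fderiv ℝ (inChart n f x) (chartPoint n x) (fderiv ℝ (fderiv ℝ G) (φ x) U V) := by
    intro U V
    have d1 : HasFDerivAt (fderiv ℝ (inChart n f x))
        (fderiv ℝ (fderiv ℝ (inChart n f x)) (G (φ x))) (G (φ x)) :=
      ((hh.fderiv_right (m := ∞) (by simp)).differentiableAt (by simp)).hasFDerivAt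
    have d2 : HasFDerivAt G (fderiv ℝ G (φ x)) (φ x) :=
      (hG.differentiableAt (by simp)).hasFDerivAt
    have d3 : HasFDerivAt (fderiv ℝ G) (fderiv ℝ (fderiv ℝ G) (φ x)) (φ x) :=
      ((hG.fderiv_right (m := ∞) (by simp)).differentiableAt (by simp)).hasFDerivAt
    refine (congrArg (fun T => T U V)
      (hdF.fderiv_eq.trans ((d1.comp (φ x) d2).clm_comp d3).fderiv)).trans ?_
    rw [← hGz]
    simp [add_comm]
  have hLF : ∀ U, differential n f x (fderiv ℝ G (φ x) U) = fderiv ℝ (f ∘ φ.symm) (φ x) U :=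
    fun U => by
    have h1 : fderiv ℝ (f ∘ φ.symm) (φ x) =
        (fderiv ℝ (inChart n f x) (G (φ x))).comp (fderiv ℝ G (φ x)) := hdF.self_of_nhds
    rw [hD, h1, hGz]
    rfl
  have hconf : ∀ U V, g.inner x (fderiv ℝ G (φ x) U) (fderiv ℝ G (φ x) V) =
      (lam x ^ 2)⁻¹ * inner ℝ U V := by
    intro U V
    refine (hf.2 x _ _).symm.trans ?_
    rw [hLF, hLF, hφ.inner_fderiv_comp hf hz, φ.left_inv hx]
  have hinj : Function.Injective (fderiv ℝ G (φ x)) := by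
    refine (injective_iff_map_eq_zero _).2 fun U hU => ?_
    have h1 := hconf U U
    rw [hU] at h1
    have h2 : (0 : ℝ) = (lam x ^ 2)⁻¹ * inner ℝ U U :=
      (congrArg (fun T : Tan n x →L[ℝ] ℝ => T 0) (map_zero (g.inner x))).symm.trans h1
    exact inner_self_eq_zero.1 ((mul_eq_zero.1 h2.symm).resolve_left hpos.ne')
  refine ⟨LinearEquiv.ofInjectiveEndo (fderiv ℝ G (φ x) : Euc n →ₗ[ℝ] Euc n) hinj, hconf,
    fun U V => ?_⟩
  have htan : (normalSpace n f x).starProjection (fderiv ℝ (inChart n f x) (chartPoint n x)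
      (fderiv ℝ (fderiv ℝ G) (φ x) U V)) = 0 := by
    rw [Submodule.starProjection_apply_eq_zero_iff, normalSpace_eq_of_mdifferentiableAt hfx]
    exact Submodule.le_orthogonal_orthogonal _ ⟨_, rfl⟩
  rw [hddF, map_add, htan, add_zero]
  rfl

end EuclideanSubmanifold

/-! ### Quasiumbilicity -/

namespace EuclideanSubmanifold

open Filter Topology

variable {n N : ℕ} {M : Type*} [TopologicalSpace M] [ChartedSpace (Euc n) M]
  [IsManifold 𝓘(ℝ, Euc n) ∞ M] {g : Metric n M}

theorem finrank_normalSpace {p : ℕ} {f : M → Euc (n + p)} (hf : IsIsometricImmersion n g f)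
    (x : M) : Module.finrank ℝ (normalSpace n f x) = p := by
  have hinj : Function.Injective (differential n f x).toLinearMap := by
    refine (injective_iff_map_eq_zero _).2 fun X hX => ?_
    have hX' : differential n f x X = 0 := hX
    by_contra h
    have h1 := hf.2 x X X
    rw [hX', inner_zero_left] at h1
    exact (g.pos x X h).ne h1
  have h1 := Submodule.finrank_add_finrank_orthogonal (differential n f x).range
  have h2 : Module.finrank ℝ (differential n f x).range = n :=
    (LinearMap.finrank_range_of_inj hinj).trans finrank_euclideanSpace_fin
  rw [h2, finrank_euclideanSpace_fin] at h1
  exact Nat.add_left_cancel h1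

/-- Pairing with all tangent vectors detects equality, for the metric `g`. -/
theorem eq_of_forall_inner_eq {x : M} {X X' : Tan n x}
    (h : ∀ Y, g.inner x X Y = g.inner x X' Y) : X = X' := by
  refine sub_eq_zero.1 ((metricForm_nondegenerate n g x).1 (X - X') fun Y => ?_)
  change g.inner x (X - X') Y = 0
  rw [map_sub]
  exact sub_eq_zero.2 (h Y)

/-- In a conformal chart, a frame of `ℝⁿ` diagonalizes the second fundamental form, with principal
normals `l i` satisfying the relation that expresses the vanishing of the Weyl tensor. -/
theorem exists_diagonalizing_frame (hg : IsConformallyFlat n g) {f : M → Euc N}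
    (hf : IsIsometricImmersion n g f) (hflat : HasFlatNormalBundle n f) (x : M) :
    ∃ (ρ : ℝ) (L : Euc n ≃ₗ[ℝ] Tan n x) (e : OrthonormalBasis (Fin n) ℝ (Euc n))
      (l : Fin n → normalSpace n f x) (s : Fin n → ℝ), 0 < ρ ∧
      (∀ U V, g.inner x (L U) (L V) = ρ * inner ℝ U V) ∧
      (∀ U V, secondFundamentalForm n f x (L U) (L V) =
        secondFundamentalForm n f x (L V) (L U)) ∧
      (∀ i V, secondFundamentalForm n f x (L (e i)) (L V) = inner ℝ (e i) V • (l i : Euc N)) ∧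
      ∀ i j, i ≠ j → inner ℝ (l i) (l j) = s i + s j := by
  obtain ⟨φ, lam, hx, h1, h2, h3, h4⟩ := hg x
  have hφ : IsConformalChart g φ lam :=
    ⟨h1, h2, h3, fun y hy => (h4 y hy).1, fun y hy => (h4 y hy).2⟩
  have hz := φ.map_source hx
  obtain ⟨L, hLg, hLα⟩ := hφ.exists_linearEquiv hf hx
  obtain ⟨Q, hQ, hQU⟩ := hφ.exists_smooth_normalProjection hf
  have hρ : 0 < (lam x ^ 2)⁻¹ := inv_pos.2 (pow_pos (hφ.pos _ hx) 2)
  have hF := hφ.contDiffAt_comp hf.1 hz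
  have hN := hφ.normalSpace_symm hf.1 hz
  rw [φ.left_inv hx] at hN
  set ρ := (lam x ^ 2)⁻¹
  have hsymm : ∀ U V, secondFundamentalForm n f x (L U) (L V) =
      secondFundamentalForm n f x (L V) (L U) := fun U V => by
    rw [hLα, hLα, (hF.isSymmSndFDerivAt (by simp [ENat.LEInfty.out]) :
      IsSymmSndFDerivAt ℝ (f ∘ φ.symm) (φ x)) U V]
  have hmem : ∀ U V, secondFundamentalForm n f x (L U) (L V) ∈ normalSpace n f x := fun U V =>
    Submodule.starProjection_apply_mem _ _
  let S : normalSpace n f x → Module.End ℝ (Euc n) := fun ζ =>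
    ρ • (L.symm.toLinearMap ∘ₗ shapeOperator n g f x ζ ∘ₗ L.toLinearMap)
  have hSL : ∀ ζ U, L (S ζ U) = ρ • shapeOperator n g f x ζ (L U) := fun ζ U => by
    simp [S]
  have hS : ∀ (ζ : normalSpace n f x) U V, inner ℝ (S ζ U) V =
      inner ℝ (secondFundamentalForm n f x (L U) (L V)) (ζ : Euc N) := fun ζ U V => by
    have h := hLg (S ζ U) V
    rw [hSL, map_smul] at h
    have h' : ρ * g.inner x (shapeOperator n g f x ζ (L U)) (L V) = ρ * inner ℝ (S ζ U) V := h
    rw [← mul_left_cancel₀ hρ.ne' h', inner_shapeOperator]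
  have hc : ∀ (ζ ξ : normalSpace n f x) U V,
      inner ℝ (S ζ U) (S ξ V) = inner ℝ (S ζ V) (S ξ U) := fun ζ ξ U V => by
    refine mul_left_cancel₀ hρ.ne' ?_
    rw [← hLg, ← hLg, hSL, hSL, hSL, hSL]
    simp only [map_smul, smul_apply]
    rw [shapeOperator_comm hf hflat φ.open_source hx hQ hQU ζ.2 ξ.2]
  obtain ⟨e, l, hel⟩ := exists_orthonormalBasis_diagonalizing finrank_euclideanSpace_fin
    (normalSpace n f x) (B := fun U V => secondFundamentalForm n f x (L U) (L V)) hmem hsymm hS hc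
  have hconf : ∀ᶠ y in 𝓝 (φ x), ∀ U V, inner ℝ (fderiv ℝ (f ∘ φ.symm) y U)
      (fderiv ℝ (f ∘ φ.symm) y V) = (lam (φ.symm y) ^ 2)⁻¹ * inner ℝ U V := by
    filter_upwards [φ.open_target.mem_nhds hz] with y hy U V
    exact hφ.inner_fderiv_comp hf hy U V
  obtain ⟨s, hs⟩ := exists_sum_eq_gauss_of_conformal (hF.of_le ENat.LEInfty.out)
    ((hφ.contDiffAt_factor hz).of_le ENat.LEInfty.out)
    (by rw [φ.left_inv hx]; exact hρ) hconf
    (B := fun U V => secondFundamentalForm n f x (L U) (L V))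
    (fun U V => by simp only [hLα, hN])
  refine ⟨ρ, L, e, l, fun i => s (e i), hρ, hLg, hsymm, hel, fun i j hij => ?_⟩
  have h := hs (e i) (e j) (e.orthonormal.1 i) (e.orthonormal.1 j) (e.orthonormal.2 hij)
  have hone : ∀ k, inner ℝ (e k) (e k) = (1 : ℝ) := fun k => by
    rw [real_inner_self_eq_norm_sq, e.orthonormal.1 k]; norm_num
  have hzero : inner ℝ (e i) (e j) = (0 : ℝ) := e.orthonormal.2 hij
  simp only [hel, hone, hzero, one_smul, zero_smul, inner_zero_left, sub_zero] at h
  exact h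

end EuclideanSubmanifold

open EuclideanSubmanifold in
/-- The pointwise statement: a single principal normal of multiplicity at least two suffices. -/
theorem quasiumbilical_at {n p m : ℕ} {M : Type*} [TopologicalSpace M]
    [ChartedSpace (Euc n) M] [IsManifold 𝓘(ℝ, Euc n) ∞ M] {g : EuclideanSubmanifold.Metric n M}
    (hg : IsConformallyFlat n g) {f : M → Euc (n + p)} (hf : IsIsometricImmersion n g f)
    (hflat : HasFlatNormalBundle n f) (hm : 2 ≤ m) {x : M} {η : Euc (n + p)}
    (hη : η ∈ normalSpace n f x) (hdim : Module.finrank ℝ (principalSpace n g f x η) = m) :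
    n ≤ p + m ∧ ∃ ξ : OrthonormalBasis (Fin p) ℝ (normalSpace n f x), ∀ j : Fin p, ∃ c : ℝ,
      n - 1 ≤ Module.finrank ℝ (Module.End.eigenspace (shapeOperator n g f x (ξ j)) c) := by
  obtain ⟨ρ, L, e, l, s, hρ, hLg, hsymm, hel, hl⟩ := exists_diagonalizing_frame hg hf hflat x
  let η' : normalSpace n f x := ⟨ρ • η, Submodule.smul_mem _ _ hη⟩
  have hcard : Nat.card {i // l i = η'} = m := by
    have h1 := card_eq_finrank_of_diagonal
      (B := fun U V => secondFundamentalForm n f x (L U) (L V)) hsymm e (fun i => (l i : Euc (n + p)))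
      hel (ρ • η) (K := (principalSpace n g f x η).map L.symm.toLinearMap) (fun U => by
        rw [Submodule.mem_map_equiv]
        constructor
        · intro hU V
          refine (hU (L V)).trans ?_
          rw [LinearEquiv.symm_symm, hLg, smul_smul, mul_comm]
        · intro hU Y
          obtain ⟨V, rfl⟩ := L.surjective Y
          refine (hU V).trans ?_
          rw [LinearEquiv.symm_symm, hLg, smul_smul, mul_comm])
    rw [← hdim, ← LinearEquiv.finrank_map_eq L.symm (principalSpace n g f x η), ← h1]
    exact Nat.card_congr (Equiv.subtypeEquivRight fun i => Subtype.ext_iff)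
  obtain ⟨hle, b, hb⟩ := exists_orthonormalBasis_of_inner_eq_add (finrank_normalSpace hf x) l η' s
    hl hm hcard
  refine ⟨hle, b, fun j => ⟨inner ℝ η (b j : Euc (n + p)), ?_⟩⟩
  obtain ⟨i₀, hi₀⟩ := hb j
  have hmem : ∀ i : {i // i ≠ i₀}, L (e i) ∈ Module.End.eigenspace
      (shapeOperator n g f x (b j)) (inner ℝ η (b j : Euc (n + p))) := by
    intro i
    refine Module.End.mem_eigenspace_iff.2 (eq_of_forall_inner_eq (g := g) fun Y => ?_)
    obtain ⟨V, rfl⟩ := L.surjective Y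
    have h1 : inner ℝ (l i : Euc (n + p)) (b j : Euc (n + p)) =
        inner ℝ (ρ • η) (b j : Euc (n + p)) := hi₀ i i.2
    rw [inner_shapeOperator, hel, real_inner_smul_left, h1, real_inner_smul_left, map_smul]
    change _ = _ * g.inner x (L (e i)) (L V)
    rw [hLg]
    ring
  have hli : LinearIndependent ℝ fun i : {i // i ≠ i₀} => L (e i) :=
    (e.orthonormal.linearIndependent.map' L.toLinearMap L.ker).comp _ Subtype.val_injective
  have hli' : LinearIndependent ℝ fun i : {i // i ≠ i₀} =>
      (⟨L (e i), hmem i⟩ : Module.End.eigenspace (shapeOperator n g f x (b j)) _) :=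
    LinearIndependent.of_comp (Submodule.subtype _) hli
  have h := hli'.fintype_card_le_finrank
  rwa [Fintype.card_subtype_compl, Fintype.card_fin, Fintype.card_subtype_eq] at h

theorem theorem2 {n p m : ℕ} (hn : 4 ≤ n) {M : Type*} [TopologicalSpace M] [Nonempty M]
    [ChartedSpace (EuclideanSubmanifold.Euc n) M]
    [IsManifold 𝓘(ℝ, EuclideanSubmanifold.Euc n) ∞ M]
    (g : EuclideanSubmanifold.Metric n M)
    (hg : EuclideanSubmanifold.IsConformallyFlat n g)
    (f : M → EuclideanSubmanifold.Euc (n + p))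
    (hf : EuclideanSubmanifold.IsIsometricImmersion n g f)
    (hflat : EuclideanSubmanifold.HasFlatNormalBundle n f)
    (hproper : EuclideanSubmanifold.IsProper n g f)
    (hm : 2 ≤ m)
    (η : M → EuclideanSubmanifold.Euc (n + p))
    (hη : EuclideanSubmanifold.IsPrincipalNormalField n g f η m) :
    n ≤ p + m ∧ EuclideanSubmanifold.IsQuasiumbilical g f := by
  have h := fun x : M =>
    quasiumbilical_at hg hf hflat hm (hη.1.2 x (Set.mem_univ x)) (hη.2.2 x)
  exact ⟨(h (Classical.arbitrary M)).1, fun x => (h x).2⟩
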